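/- \textbf{Theorem.} Let $n,\ell\ge 0$ be integers. In the $\ell$-limited supply auction, $n$ bidders with private values $v=(v_1,\dots,v_n)\in\mathbb{R}_{\ge 0}^n$ each want one service, and at most $\ell$ of them can be served simultaneously; let $\mathcal{X}=\{x\in[0,1]^n : \sum_i x_i\le \ell\}$ be the set of feasible fractional allocations. A randomized mechanism is a probability distribution over deterministic mechanisms; it is truthful if all of these are truthful (bidding one's true value is a dominant strategy), and every realization must serve at most $\ell$ bidders, charge each served bidder between $0$ and her bid, and charge the others nothing. Then there is a family $\{\mathcal{M}^{\hat v}\}$ of truthful randomized mechanisms of this kind, one for every prediction vector $\hat v\in\mathbb{R}_{\ge 0}^n$, such that the expected revenue $\mathcal{M}^{\hat v}(v)$ of $\mathcal{M}^{\hat v}$ on the value vector $v$ satisfies \[ \mathcal{M}^{\hat v}(\hat v)\;\ge\; OPT_{\mathcal{X}}(\hat v)\quad\text{($1$-consistency)},\qquad \mathcal{M}^{\hat v}(v)\;\ge\;\frac{EFO^{(2,\ell)}(v)}{5.42}\quad\text{($5.42$-robustness)} \] for all $\hat v,v\in\mathbb{R}_{\ge 0}^n$. Here $OPT_{\mathcal{X}}(v)=\max_{x\in\mathcal{X}}\sum_i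 x_iv_i$. For $w_1\ge\cdots\ge w_n\ge 0$, \[ EFO_{\mathcal{X}}(w)=\max\Bigl\{\sum_{i=1}^n\sum_{j=i}^n w_j(x_j-x_{j+1}) \,:\, x\in\mathcal{X},\ x_1\ge\cdots\ge x_n\Bigr\},\qquad x_{n+1}:=0, \] and $EFO^{(2,\ell)}(v)=EFO_{\mathcal{X}}(v_{(2)},v_{(2)},v_{(3)},\dots,v_{(n)})$, where $v_{(1)}\ge\cdots\ge v_{(n)}$ are the entries of $v$ in nonincreasing order (and $v_{(2)}:=0$ if $n=1$). -/

import Mathlib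

open scoped NNReal

/-- A vector of values (or of bids, or of predictions): one nonnegative real per bidder. -/
abbrev Values (n : ℕ) : Type := Fin n → ℝ≥0

/-! ### Benchmarks -/

/-- The feasible (fractional) allocations when at most `ℓ` of the `n` bidders can be served:
the convex hull of the `0/1` vectors with at most `ℓ` ones. -/
def limitedSupply (n ℓ : ℕ) : Set (Fin n → ℝ) :=
  {x | (∀ i, 0 ≤ x i ∧ x i ≤ 1) ∧ ∑ i, x i ≤ (ℓ : ℝ)}

/-- `OPT_X(v) = max_{x ∈ X} ∑ i, x i * v i`. -/
noncomputable def OPT {n : ℕ} (X : Set (Fin n → ℝ)) (v : Values n) : ℝ :=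
  sSup ((fun x : Fin n → ℝ => ∑ i, x i * (v i : ℝ)) '' X)

/-- The values rearranged in nonincreasing order (index `0` holds the highest value). -/
noncomputable def sortDesc {n : ℕ} (v : Values n) : Values n :=
  fun k => v (Tuple.sort v (Fin.rev k))

/-- The vector `(v₂, v₂, v₃, …, vₙ)`, where `v₁ ≥ v₂ ≥ ⋯ ≥ vₙ` are the sorted entries of `v`
(and `v₂ = 0` if there is only one bidder). -/
noncomputable def replaceTop {n : ℕ} (v : Values n) : Values n :=
  fun k => if k.val = 0 then (if h : 1 < n then sortDesc v ⟨1, h⟩ else 0) else sortDesc v k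

/-- `x_{j+1}`, with the convention `x_{n+1} = 0`. -/
def nextEntry {n : ℕ} (x : Fin n → ℝ) (j : Fin n) : ℝ :=
  if h : j.val + 1 < n then x ⟨j.val + 1, h⟩ else 0

/-- The envy-free revenue `EF^x(v) = ∑ i, ∑ j ≥ i, v_j (x_j - x_{j+1})` of a nonincreasing
allocation `x` on a nonincreasing value vector `v`. -/
def envyFreeRevenue {n : ℕ} (x : Fin n → ℝ) (v : Values n) : ℝ :=
  ∑ i, ∑ j ∈ Finset.Ici i, (v j : ℝ) * (x j - nextEntry x j)

/-- `EFO_X(v)`: the largest envy-free revenue of a nonincreasing feasible allocation, evaluated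
on the sorted values. -/
noncomputable def EFO {n : ℕ} (X : Set (Fin n → ℝ)) (v : Values n) : ℝ :=
  sSup ((fun x : Fin n → ℝ => envyFreeRevenue x (sortDesc v)) '' {x ∈ X | Antitone x})

/-- `EFO^(2)_X(v) = EFO_X((v₂, v₂, v₃, …, vₙ))`. -/
noncomputable def EFO2 {n : ℕ} (X : Set (Fin n → ℝ)) (v : Values n) : ℝ :=
  EFO X (replaceTop v)

/-- The supremum defining `OPT` is over a bounded set. -/
theorem bddAbove_OPT {n ℓ : ℕ} (v : Values n) :
    BddAbove ((fun x : Fin n → ℝ => ∑ i, x i * (v i : ℝ)) '' limitedSupply n ℓ) := by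
  refine ⟨∑ i, (v i : ℝ), ?_⟩
  rintro _ ⟨x, hx, rfl⟩
  exact Finset.sum_le_sum fun i _ => mul_le_of_le_one_left (v i).2 (hx.1 i).2

/-- The supremum defining `EFO` is over a bounded set. -/
theorem bddAbove_EFO {n ℓ : ℕ} (v : Values n) :
    BddAbove ((fun x : Fin n → ℝ => envyFreeRevenue x (sortDesc v)) ''
      {x ∈ limitedSupply n ℓ | Antitone x}) := by
  refine ⟨∑ i, ∑ j ∈ Finset.Ici i, (sortDesc v j : ℝ), ?_⟩
  rintro _ ⟨x, hx, rfl⟩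
  refine Finset.sum_le_sum fun i _ => Finset.sum_le_sum fun j _ =>
    mul_le_of_le_one_right (sortDesc v j).2 ?_
  have := (hx.1.1 j).2
  unfold nextEntry
  split_ifs with h
  · linarith [(hx.1.1 ⟨j.val + 1, h⟩).1]
  · linarith

/-! ### Mechanisms -/

/-- A deterministic mechanism maps each bid vector to a set of served bidders and to payments. -/
structure DetMechanism (n : ℕ) where
  winners : Values n → Finset (Fin n)
  pay : Values n → Fin n → ℝ

namespace DetMechanism

variable {n : ℕ}

/-- Utility of bidder `i` with private value `t` when the bids are `b`. -/
noncomputable def utility (D : DetMechanism n) (i : Fin n) (t : ℝ≥0) (b : Values n) : ℝ :=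
  (if i ∈ D.winners b then (t : ℝ) else 0) - D.pay b i

/-- Bidding the private value is a dominant strategy for every bidder. -/
def Truthful (D : DetMechanism n) : Prop :=
  ∀ (v : Values n) (i : Fin n) (z : ℝ≥0),
    D.utility i (v i) (Function.update v i z) ≤ D.utility i (v i) v

/-- At most `ℓ` bidders are served. -/
def Feasible (D : DetMechanism n) (ℓ : ℕ) : Prop :=
  ∀ b : Values n, (D.winners b).card ≤ ℓ

/-- Served bidders pay between `0` and their bid; the other bidders pay nothing. -/
def IndividuallyRational (D : DetMechanism n) : Prop :=
  ∀ (b : Values n) (i : Fin n),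
    (i ∈ D.winners b → 0 ≤ D.pay b i ∧ D.pay b i ≤ (b i : ℝ)) ∧
    (i ∉ D.winners b → D.pay b i = 0)

end DetMechanism

/-- A randomized mechanism: a probability distribution over deterministic mechanisms, given by a
random seed `ω`, such that the outcome on every bid vector is a random variable. -/
structure RandMechanism (n : ℕ) where
  Ω : Type
  [mΩ : MeasurableSpace Ω]
  μ : MeasureTheory.Measure Ω
  [isProb : MeasureTheory.IsProbabilityMeasure μ]
  det : Ω → DetMechanism n
  measurableSet_win : ∀ (b : Values n) (i : Fin n), MeasurableSet {ω | i ∈ (det ω).winners b}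
  measurable_pay : ∀ (b : Values n) (i : Fin n), Measurable fun ω => (det ω).pay b i

namespace RandMechanism

variable {n : ℕ}

/-- Expected revenue of the mechanism on the bid vector `v`. -/
noncomputable def revenue (M : RandMechanism n) (v : Values n) : ℝ :=
  letI := M.mΩ
  ∫ ω, ∑ i, (M.det ω).pay v i ∂M.μ

/-- The mechanism is a distribution over truthful deterministic mechanisms. -/
def Truthful (M : RandMechanism n) : Prop := ∀ ω, (M.det ω).Truthful

/-- Every realization serves at most `ℓ` bidders. -/
def Feasible (M : RandMechanism n) (ℓ : ℕ) : Prop := ∀ ω, (M.det ω).Feasible ℓ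

/-- Every realization is individually rational and makes no payments to the bidders. -/
def IndividuallyRational (M : RandMechanism n) : Prop := ∀ ω, (M.det ω).IndividuallyRational

/-- The expected revenue is a genuine integral as soon as individual rationality holds. -/
theorem IndividuallyRational.integrable {M : RandMechanism n} (h : M.IndividuallyRational)
    (v : Values n) :
    letI := M.mΩ
    MeasureTheory.Integrable (fun ω => ∑ i, (M.det ω).pay v i) M.μ := by
  let _ := M.mΩ
  have := M.isProb
  refine MeasureTheory.integrable_finsetSum _ fun i _ => ?_
  refine MeasureTheory.Integrable.of_bound (M.measurable_pay v i).aestronglyMeasurable (v i : ℝ)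
    (Filter.Eventually.of_forall fun ω => ?_)
  by_cases hi : i ∈ (M.det ω).winners v
  · obtain ⟨h0, h1⟩ := (h ω v i).1 hi
    rwa [Real.norm_of_nonneg h0]
  · rw [(h ω v i).2 hi]
    simp

end RandMechanism

/-- A learning-augmented mechanism `M` (one mechanism for each prediction vector) is
`ρ`-consistent against the benchmark `f`: under a perfect prediction its expected revenue is at
least `f / ρ`. -/
def Consistent {n : ℕ} (M : Values n → RandMechanism n) (ρ : ℝ) (f : Values n → ℝ) : Prop :=
  ∀ vhat : Values n, f vhat / ρ ≤ (M vhat).revenue vhat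

/-- `M` is `α`-robust against the benchmark `f`: whatever the prediction, its expected revenue is
at least `f / α`. -/
def Robust {n : ℕ} (M : Values n → RandMechanism n) (α : ℝ) (f : Values n → ℝ) : Prop :=
  ∀ vhat v : Values n, f v / α ≤ (M vhat).revenue v

open Finset MeasureTheory

/-! With no supply, nothing is sold and both benchmarks are at most zero. Otherwise write the supply
as L = `ℓ + 1` and mix four auctions, each serving the top L scores subject to reserves that do not
depend on the bidder's own bid; these are truthful by the usual threshold argument. When the bids
equal the prediction, all four use the predicted values as reserves, so each collects the L highest
values. This gives consistency for any mixing weights.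

For robustness, let d be the number of bids that differ from the prediction and v₁ ≥ v₂ ≥ ⋯ the
sorted bids. Auction 0 always posts the predicted values. The others do so only when few other
bidders are seen to deviate: at most one for auction 1 (otherwise Vickrey), none for auction 2
(otherwise one-item Vickrey) and auction 3 (otherwise consensus cost sharing). A bidder sees d or d
- 1 deviations, so auction 1 has mixed reserves at d = 2, auctions 2 and 3 at d = 1. Different
values of d therefore call on different auctions.

The key inequality is EFO² ≤ R₀ + R₁ + 2R₂ + 2 log 2 · R₃ for their revenues
(`EFO2_le_mixedRevenue`). For d ≤ 2 it starts from EFO² ≤ v₂ + v₂ + v₃ + ⋯ + v_L. For d ≤ 1, R₁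
covers v₂ + ⋯ + v_L and R₀ covers the extra v₂. For d = 2, R₀ covers v₃ + ⋯ + v_L and 2R₂ covers
both copies of v₂. For d ≥ 3 (and L ≥ 2), EFO² is at most the Vickrey bound L·v_{L+1} plus the best
single-price revenue k·v_k with 2 ≤ k ≤ L. Here R₁ covers the first term, 2R₂ covers 2v_k, and
consensus covers (k - 2)v_k through R₃. The coefficients add up to 4 + 2 log 2 ≤ 5.42; auction 0
receives the slack. -/

/-- The rearrangement of the bidders into nonincreasing order of value. -/
noncomputable def descEquiv {n : ℕ} (v : Values n) : Fin n ≃ Fin n := Fin.revPerm.trans (Tuple.sort v)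

/-- The `(k+1)`-st highest value, and `0` if there are at most `k` bidders. -/
noncomputable def ordStat {n : ℕ} (v : Values n) (k : ℕ) : ℝ≥0 :=
  if h : k < n then sortDesc v ⟨k, h⟩ else 0

/-- The set of the `ℓ` bidders with the highest values. -/
noncomputable def top {n : ℕ} (ℓ : ℕ) (v : Values n) : Finset (Fin n) :=
  univ.filter fun i => ((descEquiv v).symm i).val < ℓ

/-! ### Order statistics: counting above a price, perturbation of bids, sums of top values. -/

section OrderStatistics

variable {n : ℕ}

theorem sortDesc_eq (v : Values n) (k : Fin n) : sortDesc v k = v (descEquiv v k) := rfl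

theorem sortDesc_antitone (v : Values n) : Antitone (sortDesc v) := fun _ _ h =>
  Tuple.monotone_sort v (Fin.rev_le_rev.2 h)

theorem Antitone.le_apply_iff_lt_card {f : Fin n → ℝ≥0} (hf : Antitone f) (p : ℝ≥0) (k : Fin n) :
    p ≤ f k ↔ k.val < #{j | p ≤ f j} := by
  constructor
  · intro h
    have hs : Iic k ⊆ univ.filter fun j => p ≤ f j := fun j hj => by
      simpa using h.trans (hf (mem_Iic.1 hj))
    have := card_le_card hs
    rw [Fin.card_Iic] at this
    omega
  · intro h
    by_contra hk
    have hs : (univ.filter fun j => p ≤ f j) ⊆ Iio k := fun j hj => by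
      simp only [mem_filter, mem_univ, true_and] at hj
      rw [mem_Iio]
      by_contra hjk
      exact hk (hj.trans (hf (not_lt.1 hjk)))
    have := card_le_card hs
    rw [Fin.card_Iio] at this
    omega

theorem card_le_sortDesc (v : Values n) (p : ℝ≥0) :
    #{j | p ≤ sortDesc v j} = #{j | p ≤ v j} := by
  refine card_equiv (descEquiv v) fun i => ?_
  rw [mem_filter, mem_filter, sortDesc_eq]
  simp

/-- Reduces comparisons of order statistics to counting bidders above a price, free of tie-breaking.
Positivity of `p` is essential: the default value of `ordStat` beyond the last bidder is `0`. -/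
theorem le_ordStat_iff {v : Values n} {p : ℝ≥0} (hp : 0 < p) {k : ℕ} :
    p ≤ ordStat v k ↔ k < #{j | p ≤ v j} := by
  unfold ordStat
  split_ifs with h
  · rw [(sortDesc_antitone v).le_apply_iff_lt_card, card_le_sortDesc]
  · have : #{j | p ≤ v j} ≤ n := by simpa using card_filter_le univ fun j => p ≤ v j
    constructor
    · intro h'; exact absurd hp (not_lt.2 h')
    · intro h'; omega

theorem ordStat_antitone (v : Values n) : Antitone (ordStat v) := by
  intro a b hab
  by_cases h0 : ordStat v b = 0
  · simp [h0]
  · have hp := pos_iff_ne_zero.2 h0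
    exact (le_ordStat_iff hp).2 (hab.trans_lt ((le_ordStat_iff hp).1 le_rfl))

theorem ordStat_eq_zero (v : Values n) {k : ℕ} (h : n ≤ k) : ordStat v k = 0 :=
  dif_neg (not_lt.2 h)

theorem ordStat_descEquiv_symm (v : Values n) (i : Fin n) :
    ordStat v ((descEquiv v).symm i) = v i := by
  simp [ordStat, sortDesc_eq]

/-- If at most `m` entries drop, then the order statistics drop by at most `m` places. -/
theorem ordStat_add_le {v z : Values n} {m : ℕ} (h : #{j | ¬ v j ≤ z j} ≤ m) (k : ℕ) :
    ordStat v (k + m) ≤ ordStat z k := by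
  by_cases h0 : ordStat v (k + m) = 0
  · simp [h0]
  have hp := pos_iff_ne_zero.2 h0
  have hlt := (le_ordStat_iff hp).1 le_rfl
  refine (le_ordStat_iff hp).2 ?_
  set p := ordStat v (k + m)
  have hs : (univ.filter fun j => p ≤ v j) ⊆
      (univ.filter fun j => p ≤ z j) ∪ univ.filter fun j => ¬ v j ≤ z j := fun j hj => by
    simp only [mem_filter, mem_univ, true_and, mem_union] at hj ⊢
    by_cases hvz : v j ≤ z j
    · exact Or.inl (hj.trans hvz)
    · exact Or.inr hvz
  have := (card_le_card hs).trans (card_union_le _ _)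
  omega

theorem ordStat_mono {v z : Values n} (h : ∀ j, v j ≤ z j) (k : ℕ) :
    ordStat v k ≤ ordStat z k :=
  ordStat_add_le (m := 0) (by simp [h]) k

theorem ordStat_succ_le_update (v : Values n) (i : Fin n) (k : ℕ) :
    ordStat v (k + 1) ≤ ordStat (Function.update v i 0) k := by
  refine ordStat_add_le (m := 1) ?_ k
  rw [card_le_one]
  have key : ∀ j, j ∈ univ.filter (fun j => ¬ v j ≤ Function.update v i 0 j) → j = i := by
    intro j hj
    by_contra hji
    simp [Function.update_of_ne hji] at hj
  intro a ha b hb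
  rw [key a ha, key b hb]

theorem update_zero_le (v : Values n) (i j : Fin n) : Function.update v i 0 j ≤ v j := by
  by_cases h : j = i
  · subst h; simp
  · rw [Function.update_of_ne h]

/-- If `i` reaches the price `p` and `k` others do, then `k + 1` bidders do. -/
theorem le_ordStat_succ_of_update {v : Values n} {i : Fin n} {p : ℝ≥0} (hp : 0 < p) (hi : p ≤ v i)
    {k : ℕ} (h : p ≤ ordStat (Function.update v i 0) k) : p ≤ ordStat v (k + 1) := by
  rw [le_ordStat_iff hp] at h ⊢
  have hs : insert i (univ.filter fun j => p ≤ Function.update v i 0 j) ⊆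
      univ.filter fun j => p ≤ v j := by
    intro j hj
    rw [mem_insert] at hj
    rcases hj with rfl | hj
    · simpa using hi
    · simp only [mem_filter, mem_univ, true_and] at hj ⊢
      exact hj.trans (update_zero_le v i j)
  have hni : i ∉ univ.filter fun j => p ≤ Function.update v i 0 j := by
    simpa using hp.ne'
  have := card_le_card hs
  rw [card_insert_of_notMem hni] at this
  omega

theorem mem_top {ℓ : ℕ} {v : Values n} {i : Fin n} :
    i ∈ top ℓ v ↔ ((descEquiv v).symm i).val < ℓ := by simp [top]

theorem card_top (ℓ : ℕ) (v : Values n) : #(top ℓ v) = min ℓ n := by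
  have : #(top ℓ v) = #(univ.filter fun k : Fin n => k.val < ℓ) :=
    card_equiv (descEquiv v).symm (by simp [mem_top])
  rw [this, Fin.card_filter_val_lt, min_comm]

theorem ordStat_le_of_mem_top {ℓ : ℕ} {v : Values n} {i : Fin n} (h : i ∈ top ℓ v) {k : ℕ}
    (hk : ℓ ≤ k + 1) : ordStat v k ≤ v i := by
  rw [← ordStat_descEquiv_symm v i]
  exact ordStat_antitone v (by have := mem_top.1 h; omega)

theorem le_ordStat_of_notMem_top {ℓ : ℕ} {v : Values n} {i : Fin n} (h : i ∉ top ℓ v) :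
    v i ≤ ordStat v ℓ := by
  rw [← ordStat_descEquiv_symm v i]
  exact ordStat_antitone v (not_lt.1 fun h' => h (mem_top.2 h'))

/-- A bidder among the top `ℓ + 1` beats the `(ℓ+1)`-st highest of the others. -/
theorem ordStat_update_le_of_mem_top {ℓ : ℕ} {v : Values n} {i : Fin n} (h : i ∈ top (ℓ + 1) v) :
    ordStat (Function.update v i 0) ℓ ≤ v i := by
  by_contra! hlt
  have hp : 0 < ordStat (Function.update v i 0) ℓ := (zero_le).trans_lt hlt
  have h1 := (le_ordStat_iff hp).1 le_rfl
  set p := ordStat (Function.update v i 0) ℓ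
  -- Everyone reaching `p` is strictly above `v i`, hence precedes `i` in the sorted order. There
  -- are more than `ℓ` such bidders, too many for `i` to be among the first `ℓ + 1`.
  have hs : (univ.filter fun j => p ≤ Function.update v i 0 j).image (descEquiv v).symm ⊆
      Iio ((descEquiv v).symm i) := by
    intro k hk
    obtain ⟨j, hj, rfl⟩ := mem_image.1 hk
    simp only [mem_filter, mem_univ, true_and] at hj
    rw [mem_Iio]
    by_contra hle
    have := ordStat_antitone v (not_lt.1 hle)
    rw [ordStat_descEquiv_symm, ordStat_descEquiv_symm] at this
    exact absurd (hlt.trans_le (hj.trans ((update_zero_le v i j).trans this))) (lt_irrefl _)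
  have h2 := card_le_card hs
  rw [card_image_of_injective _ (descEquiv v).symm.injective, Fin.card_Iio] at h2
  have := mem_top.1 h
  omega

theorem mem_top_of_ordStat_update_lt {ℓ : ℕ} {v : Values n} {i : Fin n}
    (h : ordStat (Function.update v i 0) ℓ < v i) : i ∈ top (ℓ + 1) v := by
  by_contra hn
  have := le_ordStat_of_notMem_top hn
  exact absurd (h.trans_le (this.trans (ordStat_succ_le_update v i ℓ))) (lt_irrefl _)

theorem sum_ordStat (v : Values n) (f : ℝ≥0 → ℝ) :
    ∑ k ∈ range n, f (ordStat v k) = ∑ i, f (v i) := by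
  rw [← Fin.sum_univ_eq_sum_range fun k => f (ordStat v k)]
  refine Fintype.sum_equiv (descEquiv v) _ _ fun k => ?_
  simp [ordStat, sortDesc_eq]

/-- The sum of the `ℓ` highest values is at most `ℓ τ + ∑ (v_i - τ)⁺`. -/
theorem sum_range_ordStat_le (v : Values n) (ℓ : ℕ) (τ : ℝ≥0) :
    ∑ k ∈ range ℓ, (ordStat v k : ℝ) ≤ ℓ * (τ : ℝ) + ∑ i, max ((v i : ℝ) - τ) 0 := by
  rw [← sum_ordStat v fun y => max ((y : ℝ) - τ) 0]
  have h1 : ∑ k ∈ range ℓ, (ordStat v k : ℝ) ≤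
      ∑ k ∈ range ℓ, ((τ : ℝ) + max ((ordStat v k : ℝ) - τ) 0) :=
    sum_le_sum fun k _ => by linarith [le_max_left ((ordStat v k : ℝ) - τ) 0]
  refine h1.trans ?_
  rw [sum_add_distrib, sum_const, card_range, nsmul_eq_mul]
  refine add_le_add le_rfl ?_
  rcases le_total ℓ n with h | h
  · exact sum_le_sum_of_subset_of_nonneg (range_subset_range.2 h) fun _ _ _ => le_max_right _ _
  · refine (sum_subset (range_subset_range.2 h) fun k _ hk => ?_).ge
    rw [ordStat_eq_zero v (by simpa using hk)]
    simp

/-- A payment rule on the top `ℓ` of `y`, each paying at least `z_i` and the highest excluded value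
of `y ≥ z`, collects the sum of the `ℓ` highest values of `z`. -/
theorem sum_range_ordStat_le_sum_top {y z : Values n} {ℓ : ℕ} (hzy : ∀ i, z i ≤ y i)
    {π : Fin n → ℝ} (h1 : ∀ i ∈ top ℓ y, (z i : ℝ) ≤ π i)
    (h2 : ∀ i ∈ top ℓ y, (ordStat y ℓ : ℝ) ≤ π i) :
    ∑ k ∈ range ℓ, (ordStat z k : ℝ) ≤ ∑ i ∈ top ℓ y, π i := by
  -- Duality with the highest excluded value of `y` as the price of a unit. Since `z ≤ y`, no
  -- excluded bidder has positive surplus at that price.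
  refine (sum_range_ordStat_le z ℓ (ordStat y ℓ)).trans ?_
  have e : ∑ i, max ((z i : ℝ) - ordStat y ℓ) 0 =
      ∑ i ∈ top ℓ y, max ((z i : ℝ) - ordStat y ℓ) 0 := by
    refine (sum_subset (subset_univ _) fun i _ hi => ?_).symm
    have := (hzy i).trans (le_ordStat_of_notMem_top hi)
    rw [max_eq_right (sub_nonpos.2 (by exact_mod_cast this))]
  have e2 : (ℓ : ℝ) * ordStat y ℓ = ∑ i ∈ top ℓ y, (ordStat y ℓ : ℝ) := by
    rw [sum_const, card_top, nsmul_eq_mul]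
    rcases le_total ℓ n with h | h
    · rw [min_eq_left h]
    · simp [ordStat_eq_zero y h]
  rw [e, e2, ← sum_add_distrib]
  refine sum_le_sum fun i hi => ?_
  rcases max_choice ((z i : ℝ) - ordStat y ℓ) 0 with h | h <;> rw [h]
  · linarith [h1 i hi]
  · linarith [h2 i hi]

end OrderStatistics

/-! ### Upper bounds on the optimal welfare and on the envy-free benchmark. -/

section Benchmarks

variable {n : ℕ}

theorem sortDesc_of_antitone {v : Values n} (hv : Antitone v) : sortDesc v = v := by
  funext k
  refine eq_of_forall_le_iff fun p => ?_
  rw [(sortDesc_antitone v).le_apply_iff_lt_card, card_le_sortDesc, hv.le_apply_iff_lt_card]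

theorem replaceTop_eq (v : Values n) (k : Fin n) : replaceTop v k = ordStat v (max 1 k.val) := by
  unfold replaceTop
  split_ifs with h h1
  · rw [h, ordStat, dif_pos (by simpa using h1)]; rfl
  · rw [h, ordStat, dif_neg (by simpa using h1)]
  · have : max 1 k.val = k.val := by omega
    rw [this, ordStat, dif_pos k.isLt]

theorem sortDesc_replaceTop (v : Values n) (k : Fin n) :
    sortDesc (replaceTop v) k = ordStat v (max 1 k.val) := by
  rw [sortDesc_of_antitone, replaceTop_eq]
  intro a b hab
  rw [replaceTop_eq, replaceTop_eq]
  exact ordStat_antitone v (max_le_max le_rfl hab)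

theorem sum_Ici_sub_nextEntry (x : Fin n → ℝ) (i : Fin n) :
    ∑ j ∈ Ici i, (x j - nextEntry x j) = x i := by
  let X : ℕ → ℝ := fun k => if h : k < n then x ⟨k, h⟩ else 0
  have hX : ∀ j : Fin n, X j = x j := fun j => by simp [X]
  have hX' : ∀ j : Fin n, nextEntry x j = X (j + 1) := fun j => rfl
  have h1 : ∑ j ∈ Ici i, (x j - nextEntry x j) =
      ∑ k ∈ range n, if i.val ≤ k then X k - X (k + 1) else 0 := by
    rw [← Fin.sum_univ_eq_sum_range fun k => if i.val ≤ k then X k - X (k + 1) else 0,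
      ← sum_filter]
    refine sum_congr (by ext j; simp) fun j _ => by rw [hX, hX']
  have h2 : (range n).filter (fun k => i.val ≤ k) = Ico i.val n := by
    ext k; simp [and_comm]
  rw [h1, ← sum_filter, h2]
  have h3 := sum_Ico_sub X i.isLt.le
  have h4 : X n = 0 := by simp [X]
  rw [hX, h4] at h3
  have h5 : ∑ k ∈ Ico i.val n, (X k - X (k + 1)) = - ∑ k ∈ Ico i.val n, (X (k + 1) - X k) := by
    rw [← sum_neg_distrib]; exact sum_congr rfl fun _ _ => by ring
  rw [h5, h3]; ring

theorem nextEntry_le {x : Fin n → ℝ} (hx : Antitone x) (h0 : ∀ i, 0 ≤ x i) (j : Fin n) :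
    0 ≤ x j - nextEntry x j := by
  unfold nextEntry
  split_ifs with h
  · exact sub_nonneg.2 (hx (Fin.mk_le_mk.2 (by simp)))
  · simpa using h0 j

/-- In the inner sum each `w j` with `j ≥ i` is at most `w i`, and the decrements of `x` from `i` on
telescope to `x i`. -/
theorem envyFreeRevenue_le_sum {x : Fin n → ℝ} (hx : Antitone x) (h0 : ∀ i, 0 ≤ x i)
    {w : Values n} (hw : Antitone w) : envyFreeRevenue x w ≤ ∑ i, x i * (w i : ℝ) := by
  refine sum_le_sum fun i _ => ?_
  rw [← sum_Ici_sub_nextEntry x i, sum_mul]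
  refine sum_le_sum fun j hj => ?_
  rw [mul_comm]
  exact mul_le_mul_of_nonneg_left (by exact_mod_cast hw (mem_Ici.1 hj)) (nextEntry_le hx h0 j)

/-- An allocation of at most `ℓ` units has welfare at most `ℓ τ + ∑ (z_i - τ)⁺`. -/
theorem sum_mul_le_of_mem_limitedSupply {ℓ : ℕ} {x : Fin n → ℝ} (hx : x ∈ limitedSupply n ℓ)
    (z : Values n) (τ : ℝ≥0) :
    ∑ i, x i * (z i : ℝ) ≤ ℓ * (τ : ℝ) + ∑ i, max ((z i : ℝ) - τ) 0 := by
  have h1 : ∑ i, x i * (z i : ℝ) ≤ ∑ i, (x i * τ + max ((z i : ℝ) - τ) 0) := by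
    refine sum_le_sum fun i _ => ?_
    have h2 : x i * ((z i : ℝ) - τ) ≤ max ((z i : ℝ) - τ) 0 := by
      rcases le_total 0 ((z i : ℝ) - τ) with h | h
      · exact (mul_le_of_le_one_left h (hx.1 i).2).trans (le_max_left _ _)
      · exact (mul_nonpos_of_nonneg_of_nonpos (hx.1 i).1 h).trans (le_max_right _ _)
    linarith
  refine h1.trans ?_
  rw [sum_add_distrib, ← sum_mul]
  exact add_le_add (mul_le_mul_of_nonneg_right hx.2 τ.2) le_rfl

/-- Weak duality with unit price `ordStat v ℓ`: the surpluses vanish outside the top `ℓ`, and inside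
it price plus surplus is the value. -/
theorem OPT_le (ℓ : ℕ) (v : Values n) :
    OPT (limitedSupply n ℓ) v ≤ ∑ i ∈ top ℓ v, (v i : ℝ) := by
  refine Real.sSup_le ?_ (sum_nonneg fun i _ => (v i).2)
  rintro _ ⟨x, hx, rfl⟩
  refine (sum_mul_le_of_mem_limitedSupply hx v (ordStat v ℓ)).trans ?_
  have e : ∑ i, max ((v i : ℝ) - ordStat v ℓ) 0 = ∑ i ∈ top ℓ v, ((v i : ℝ) - ordStat v ℓ) := by
    rw [← sum_subset (subset_univ (top ℓ v)) fun i _ hi => max_eq_right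
      (sub_nonpos.2 (by exact_mod_cast le_ordStat_of_notMem_top hi))]
    exact sum_congr rfl fun i hi => max_eq_left
      (sub_nonneg.2 (by exact_mod_cast ordStat_le_of_mem_top hi (by omega)))
  rw [e, sum_sub_distrib, sum_const, card_top, nsmul_eq_mul]
  rcases le_total ℓ n with h | h
  · rw [min_eq_left h]; linarith
  · simp [ordStat_eq_zero v h]

theorem EFO2_le_of_forall {ℓ : ℕ} {v : Values n} {B : ℝ} (hB : 0 ≤ B)
    (h : ∀ x ∈ limitedSupply n ℓ, Antitone x →
      envyFreeRevenue x (sortDesc (replaceTop v)) ≤ B) :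
    EFO2 (limitedSupply n ℓ) v ≤ B := by
  refine Real.sSup_le ?_ hB
  rintro _ ⟨x, ⟨hx, hxa⟩, rfl⟩
  exact h x hx hxa

/-- The benchmark is at most `v₂ + v₂ + v₃ + ⋯ + v_ℓ`. -/
theorem EFO2_le_sum (ℓ : ℕ) (v : Values n) :
    EFO2 (limitedSupply n ℓ) v ≤ ∑ k ∈ range ℓ, (ordStat v (max 1 k) : ℝ) := by
  refine EFO2_le_of_forall (sum_nonneg fun i _ => (ordStat v _).2) fun x hx hxa => ?_
  refine (envyFreeRevenue_le_sum hxa (fun i => (hx.1 i).1) (sortDesc_antitone _)).trans ?_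
  set τ := ordStat v (max 1 ℓ)
  refine (sum_mul_le_of_mem_limitedSupply hx _ τ).trans ?_
  simp only [sortDesc_replaceTop]
  rw [Fin.sum_univ_eq_sum_range fun k => max ((ordStat v (max 1 k) : ℝ) - τ) 0]
  have e : ∑ k ∈ range n, max ((ordStat v (max 1 k) : ℝ) - τ) 0 ≤
      ∑ k ∈ range ℓ, max ((ordStat v (max 1 k) : ℝ) - τ) 0 := by
    rcases le_total n ℓ with h | h
    · exact sum_le_sum_of_subset_of_nonneg (range_subset_range.2 h) fun _ _ _ => le_max_right _ _
    · refine (sum_subset (range_subset_range.2 h) fun k _ hk => max_eq_right ?_).ge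
      have : ordStat v (max 1 k) ≤ τ :=
        ordStat_antitone v (max_le_max le_rfl (by simpa using hk))
      exact sub_nonpos.2 (by exact_mod_cast this)
  have e2 : ∑ k ∈ range ℓ, max ((ordStat v (max 1 k) : ℝ) - τ) 0 =
      ∑ k ∈ range ℓ, ((ordStat v (max 1 k) : ℝ) - τ) := by
    refine sum_congr rfl fun k hk => max_eq_left (sub_nonneg.2 ?_)
    exact_mod_cast ordStat_antitone v (max_le_max le_rfl (mem_range.1 hk).le)
  rw [sum_sub_distrib, sum_const, card_range, nsmul_eq_mul] at e2
  linarith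

/-- The highest revenue of a single price at which between `2` and `ℓ` items are sold. -/
noncomputable def priceRevenue (ℓ : ℕ) (v : Values n) : ℝ≥0 :=
  (Icc 2 ℓ).sup fun k => (k : ℝ≥0) * ordStat v (k - 1)

theorem le_priceRevenue {ℓ k : ℕ} (hk : 2 ≤ k) (hkl : k ≤ ℓ) (v : Values n) :
    (k : ℝ≥0) * ordStat v (k - 1) ≤ priceRevenue ℓ v :=
  le_sup (f := fun k : ℕ => (k : ℝ≥0) * ordStat v (k - 1)) (mem_Icc.2 ⟨hk, hkl⟩)

theorem exists_priceRevenue_eq {ℓ : ℕ} (hl : 2 ≤ ℓ) (v : Values n) :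
    ∃ k, 2 ≤ k ∧ k ≤ ℓ ∧ priceRevenue ℓ v = (k : ℝ≥0) * ordStat v (k - 1) := by
  obtain ⟨k, hk, h⟩ := exists_mem_eq_sup (Icc 2 ℓ) ⟨2, mem_Icc.2 ⟨le_rfl, hl⟩⟩
    fun k : ℕ => (k : ℝ≥0) * ordStat v (k - 1)
  exact ⟨k, (mem_Icc.1 hk).1, (mem_Icc.1 hk).2, h⟩

theorem priceRevenue_mono (ℓ : ℕ) {v z : Values n} (h : ∀ j, v j ≤ z j) :
    priceRevenue ℓ v ≤ priceRevenue ℓ z :=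
  sup_mono_fun fun _ _ => mul_le_mul_right (ordStat_mono h _) _

/-- The benchmark is at most the Vickrey revenue plus the best single-price revenue. -/
theorem EFO2_le_add {ℓ : ℕ} (hl : 2 ≤ ℓ) (v : Values n) :
    EFO2 (limitedSupply n ℓ) v ≤ ℓ * (ordStat v ℓ : ℝ) + priceRevenue ℓ v := by
  refine EFO2_le_of_forall (by positivity) fun x hx hxa => ?_
  -- The decrements of `x` are nonnegative weights: decrement `j` sells to the first `j + 1` bidders
  -- at their lowest value. Their total is at most `1`, and weighted by the number sold they total
  -- at most `ℓ`; the two terms of the bound use one constraint each.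
  have hd := nextEntry_le hxa fun i => (hx.1 i).1
  have hswap : ∀ f : Fin n → ℝ, ∑ i, ∑ j ∈ Ici i, f j = ∑ j : Fin n, ((j : ℝ) + 1) * f j := by
    intro f
    rw [sum_comm' (t' := univ) (s' := fun j => Iic j) (by simp)]
    refine sum_congr rfl fun j _ => ?_
    rw [sum_const, Fin.card_Iic, nsmul_eq_mul]
    push_cast; ring
  have hsum : ∑ j : Fin n, ((j : ℝ) + 1) * (x j - nextEntry x j) = ∑ i, x i := by
    rw [← hswap]; simp only [sum_Ici_sub_nextEntry]
  have hone : ∑ j : Fin n, (x j - nextEntry x j) ≤ 1 := by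
    rcases n with _ | n
    · simp
    · have := sum_Ici_sub_nextEntry x 0
      rw [show Ici (0 : Fin (n + 1)) = univ by ext; simp] at this
      rw [this]; exact (hx.1 0).2
  have hw : ∀ j : Fin n, ((j : ℝ) + 1) * (sortDesc (replaceTop v) j : ℝ) ≤
      priceRevenue ℓ v + ((j : ℝ) + 1) * ordStat v ℓ := by
    intro j
    rw [sortDesc_replaceTop]
    by_cases hj : j.val < ℓ
    · have : ((j.val : ℝ≥0) + 1) * ordStat v (max 1 j.val) ≤ priceRevenue ℓ v := by
        -- A single sale is not among the prices in `priceRevenue`, but the top entry is only the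
        -- second value, so selling two units at that value dominates it.
        rcases Nat.eq_zero_or_pos j.val with h0 | h0
        · refine le_trans ?_ (le_priceRevenue le_rfl hl v)
          rw [h0]
          have : ordStat v 1 ≤ 2 * ordStat v 1 := le_mul_of_one_le_left zero_le (by norm_num)
          simpa using this
        · have := le_priceRevenue (k := j.val + 1) (by omega) hj v
          rw [max_eq_right h0]
          simpa using this
      have h' : ((j : ℝ) + 1) * ordStat v (max 1 j.val) ≤ priceRevenue ℓ v := by
        exact_mod_cast this
      have : 0 ≤ ((j : ℝ) + 1) * (ordStat v ℓ : ℝ) := by positivity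
      linarith
    · have h1 : ((ordStat v (max 1 j.val) : ℝ≥0) : ℝ) ≤ ordStat v ℓ := by
        exact_mod_cast ordStat_antitone v ((not_lt.1 hj).trans (le_max_right _ _))
      have h2 : ((j : ℝ) + 1) * (ordStat v (max 1 j.val) : ℝ) ≤ ((j : ℝ) + 1) * ordStat v ℓ :=
        mul_le_mul_of_nonneg_left h1 (by positivity)
      linarith [(priceRevenue ℓ v).2]
  calc envyFreeRevenue x (sortDesc (replaceTop v))
      = ∑ j : Fin n, ((j : ℝ) + 1) * ((sortDesc (replaceTop v) j : ℝ) * (x j - nextEntry x j)) :=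
        hswap _
    _ ≤ ∑ j : Fin n, ((priceRevenue ℓ v : ℝ) * (x j - nextEntry x j) +
          ordStat v ℓ * (((j : ℝ) + 1) * (x j - nextEntry x j))) := by
        refine sum_le_sum fun j _ => ?_
        have := mul_le_mul_of_nonneg_right (hw j) (hd j)
        linarith
    _ = priceRevenue ℓ v * ∑ j : Fin n, (x j - nextEntry x j) + ordStat v ℓ * ∑ i, x i := by
        rw [sum_add_distrib, ← mul_sum, ← mul_sum, hsum]
    _ ≤ priceRevenue ℓ v * 1 + ordStat v ℓ * ℓ := by
        gcongr
        exact hx.2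
    _ = ℓ * (ordStat v ℓ : ℝ) + priceRevenue ℓ v := by ring

end Benchmarks

/-! ### Truthful auctions with reserves, prediction-based reserves and cost sharing. -/

section Auctions

variable {n : ℕ}

/-- The `ℓ + 1` bidders of highest score win if they meet their reserves; they pay the larger of
their reserve and the `(ℓ + 1)`-st highest score of the others. -/
noncomputable def auction (ℓ : ℕ) (score reserve : Values n → Values n) : DetMechanism n where
  winners b := (top (ℓ + 1) (score b)).filter fun i => reserve b i ≤ b i
  pay b i :=
    if i ∈ (top (ℓ + 1) (score b)).filter fun i => reserve b i ≤ b i then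
      ((max (reserve b i) (ordStat (Function.update (score b) i 0) ℓ) : ℝ≥0) : ℝ)
    else 0

/-- Nobody influences her own reserve. -/
def BidIndependent (reserve : Values n → Values n) : Prop :=
  ∀ b i z, reserve (Function.update b i z) i = reserve b i

/-- Nobody influences the scores of the others, and those who meet their reserves are scored by
their bids. -/
structure ProperScore (score reserve : Values n → Values n) : Prop where
  others : ∀ b i z,
    Function.update (score (Function.update b i z)) i 0 = Function.update (score b) i 0
  self : ∀ b i, reserve b i ≤ b i → score b i = b i

theorem properScore_id (reserve : Values n → Values n) : ProperScore id reserve :=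
  ⟨fun b i z => by simp, fun _ _ _ => rfl⟩

variable {ℓ : ℕ} {score reserve : Values n → Values n}

theorem mem_winners_auction {b : Values n} {i : Fin n} :
    i ∈ (auction ℓ score reserve).winners b ↔ i ∈ top (ℓ + 1) (score b) ∧ reserve b i ≤ b i :=
  mem_filter

theorem pay_auction (b : Values n) (i : Fin n) :
    (auction ℓ score reserve).pay b i = if i ∈ (auction ℓ score reserve).winners b then
      ((max (reserve b i) (ordStat (Function.update (score b) i 0) ℓ) : ℝ≥0) : ℝ) else 0 := rfl

theorem auction_price_le (hs : ProperScore score reserve) {b : Values n} {i : Fin n}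
    (h : i ∈ (auction ℓ score reserve).winners b) :
    max (reserve b i) (ordStat (Function.update (score b) i 0) ℓ) ≤ b i := by
  obtain ⟨h1, h2⟩ := mem_winners_auction.1 h
  refine max_le h2 ?_
  rw [← hs.self b i h2]
  exact ordStat_update_le_of_mem_top h1

/-- The larger of the reserve and the competing score is a threshold `t` that the bidder cannot
influence. Truth-telling yields `max (v i - t) 0`, the best possible at a fixed price. -/
theorem auction_truthful (hr : BidIndependent reserve) (hs : ProperScore score reserve) :
    (auction ℓ score reserve).Truthful := by
  intro v i z
  set t := max (reserve v i) (ordStat (Function.update (score v) i 0) ℓ) with ht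
  have hle : (auction ℓ score reserve).utility i (v i) (Function.update v i z) ≤
      max ((v i : ℝ) - t) 0 := by
    rw [DetMechanism.utility, pay_auction, hr, hs.others, ← ht]
    split_ifs
    · exact le_max_left _ _
    · simp
  refine hle.trans ?_
  rw [DetMechanism.utility, pay_auction, ← ht]
  split_ifs with hw
  · have : (t : ℝ) ≤ v i := by exact_mod_cast auction_price_le hs hw
    exact max_le le_rfl (by linarith)
  · rw [sub_zero]
    refine max_le ?_ le_rfl
    -- Only a value strictly above `t` has to win; at equality winning and losing both give utility
    -- zero, so tie-breaking is irrelevant.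
    by_contra! hlt
    have hlt' : t < v i := by
      have : (t : ℝ) < v i := by linarith
      exact_mod_cast this
    have h1 : reserve v i ≤ v i := (le_max_left _ _).trans hlt'.le
    refine hw (mem_winners_auction.2 ⟨mem_top_of_ordStat_update_lt ?_, h1⟩)
    rw [hs.self v i h1]
    exact (le_max_right _ _).trans_lt hlt'

theorem auction_feasible : (auction ℓ score reserve).Feasible (ℓ + 1) := fun _ =>
  (card_filter_le _ _).trans ((card_top _ _).trans_le (min_le_left _ _))

theorem auction_individuallyRational (hs : ProperScore score reserve) :
    (auction ℓ score reserve).IndividuallyRational := by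
  refine fun b i => ⟨fun h => ?_, fun h => ?_⟩
  · rw [pay_auction, if_pos h]
    exact ⟨NNReal.coe_nonneg _, by exact_mod_cast auction_price_le hs h⟩
  · rw [pay_auction, if_neg h]

theorem auction_pay_nonneg (b : Values n) (i : Fin n) :
    0 ≤ (auction ℓ score reserve).pay b i := by
  rw [pay_auction]
  split_ifs
  · exact NNReal.coe_nonneg _
  · exact le_rfl

theorem reserve_le_pay {b : Values n} {i : Fin n} (h : i ∈ top (ℓ + 1) (score b))
    (hr : reserve b i ≤ b i) : (reserve b i : ℝ) ≤ (auction ℓ score reserve).pay b i := by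
  rw [pay_auction, if_pos (mem_winners_auction.2 ⟨h, hr⟩)]
  exact_mod_cast le_max_left _ _

theorem ordStat_le_pay {b : Values n} {i : Fin n} (h : i ∈ top (ℓ + 1) (score b))
    (hr : reserve b i ≤ b i) :
    (ordStat (score b) (ℓ + 1) : ℝ) ≤ (auction ℓ score reserve).pay b i := by
  rw [pay_auction, if_pos (mem_winners_auction.2 ⟨h, hr⟩)]
  exact_mod_cast (ordStat_succ_le_update _ i _).trans (le_max_right _ _)

theorem sum_le_sum_pay (b : Values n) (S : Finset (Fin n)) :
    ∑ i ∈ S, (auction ℓ score reserve).pay b i ≤ ∑ i, (auction ℓ score reserve).pay b i :=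
  sum_le_sum_of_subset_of_nonneg (subset_univ _) fun i _ _ => auction_pay_nonneg b i

/-- Reserves equal to the bids extract the full surplus. -/
theorem OPT_le_sum_pay {b : Values n} (hs : score b = b) (hr : reserve b = b) :
    OPT (limitedSupply n (ℓ + 1)) b ≤ ∑ i, (auction ℓ score reserve).pay b i := by
  refine (OPT_le _ b).trans (le_trans (sum_le_sum fun i hi => ?_)
    (sum_le_sum_pay b (top (ℓ + 1) b)))
  have := reserve_le_pay (ℓ := ℓ) (score := score) (reserve := reserve) (b := b) (i := i)
    (by rwa [hs]) (by rw [hr])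
  rwa [hr] at this

/-! ### Reserves taken from a prediction -/

/-- The number of bidders whose bids deviate from the prediction. -/
noncomputable def deviations (vhat b : Values n) : ℕ := #{j | b j ≠ vhat j}

/-- The number of bidders other than `i` whose bids deviate from the prediction. -/
noncomputable def otherDeviations (vhat b : Values n) (i : Fin n) : ℕ :=
  #{j | j ≠ i ∧ b j ≠ vhat j}

theorem otherDeviations_le (vhat b : Values n) (i : Fin n) :
    otherDeviations vhat b i ≤ deviations vhat b :=
  card_le_card fun j hj => by simp at hj ⊢; exact hj.2

theorem deviations_le (vhat b : Values n) (i : Fin n) :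
    deviations vhat b ≤ otherDeviations vhat b i + 1 := by
  refine (card_le_card (t := insert i (univ.filter fun j => j ≠ i ∧ b j ≠ vhat j))
    fun j hj => ?_).trans (card_insert_le _ _)
  simp at hj ⊢
  tauto

theorem deviations_self (v : Values n) : deviations v v = 0 := by simp [deviations]

theorem otherDeviations_update (vhat b : Values n) (i : Fin n) (z : ℝ≥0) :
    otherDeviations vhat (Function.update b i z) i = otherDeviations vhat b i := by
  unfold otherDeviations
  congr 1
  ext j
  simp only [mem_filter, mem_univ, true_and]
  refine and_congr_right fun h => ?_
  rw [Function.update_of_ne h]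

/-- The predicted value if at most `m` of the other bids deviate from the prediction, and the price
`f` suggested by the bids of the others otherwise. -/
noncomputable def trustReserve (vhat : Values n) (m : ℕ) (f : Values n → ℝ≥0) :
    Values n → Values n := fun b i =>
  if otherDeviations vhat b i ≤ m then vhat i else f (Function.update b i 0)

theorem trustReserve_bidIndependent (vhat : Values n) (m : ℕ) (f : Values n → ℝ≥0) :
    BidIndependent (trustReserve vhat m f) := fun b i z => by
  simp [trustReserve, otherDeviations_update]

theorem trustReserve_self (vhat : Values n) (m : ℕ) (f : Values n → ℝ≥0) :
    trustReserve vhat m f vhat = vhat := by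
  funext i
  have := (otherDeviations_le vhat vhat i).trans_eq (deviations_self vhat)
  exact if_pos (by omega)

theorem trustReserve_of_le {vhat b : Values n} {m : ℕ} (h : deviations vhat b ≤ m)
    (f : Values n → ℝ≥0) (i : Fin n) : trustReserve vhat m f b i = vhat i :=
  if_pos ((otherDeviations_le vhat b i).trans h)

/-- A deviator sees one deviation fewer than the others do, so only `deviations > m + 1` makes
everybody distrust. At exactly `m + 1` the reserves are mixed, and no revenue bound is claimed
there. -/
theorem trustReserve_of_lt {vhat b : Values n} {m : ℕ} (h : m + 1 < deviations vhat b)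
    (f : Values n → ℝ≥0) (i : Fin n) :
    trustReserve vhat m f b i = f (Function.update b i 0) :=
  if_neg (by have := deviations_le vhat b i; omega)

/-- The bids, with those below the prediction replaced by `0`. -/
noncomputable def keep (vhat b : Values n) : Values n := fun i => if vhat i ≤ b i then b i else 0

theorem properScore_keep (vhat : Values n) : ProperScore (keep vhat) fun _ => vhat := by
  refine ⟨fun b i z => ?_, fun b i h => if_pos h⟩
  funext j
  by_cases h : j = i
  · subst h; simp
  · simp [keep, Function.update_of_ne h]

/-- Selling at the predicted values to the highest bidders who accept them. -/
theorem le_revenue_predicted (vhat b : Values n) :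
    ∑ k ∈ range (ℓ + 1), (ordStat b (k + deviations vhat b) : ℝ) ≤
      ∑ i, (auction ℓ (keep vhat) fun _ => vhat).pay b i := by
  -- Keeps only the correctly predicted bidders, whose reserves equal their bids. At most
  -- `deviations vhat b` entries drop, so the order statistics shift by at most that many places.
  let z : Values n := fun i => if b i = vhat i then b i else 0
  have hz : ∀ k, ordStat b (k + deviations vhat b) ≤ ordStat z k := by
    refine ordStat_add_le (card_le_card fun j hj => ?_)
    simp only [mem_filter, mem_univ, true_and, z] at hj ⊢
    intro h
    exact hj (by rw [if_pos h])
  refine (sum_le_sum fun k _ => NNReal.coe_le_coe.2 (hz k)).trans ?_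
  refine le_trans (sum_range_ordStat_le_sum_top (y := keep vhat b) (fun i => ?_) (fun i hi => ?_)
    fun i hi => ?_) (sum_le_sum_pay b (top (ℓ + 1) (keep vhat b)))
  · simp only [z, keep]
    split_ifs with h1 h2 <;> first | exact le_rfl | exact zero_le | exact absurd h1.ge h2
  · by_cases h : b i = vhat i
    · have := reserve_le_pay (reserve := fun _ => vhat) hi h.ge
      simpa [z, h] using this
    · simpa [z, h] using auction_pay_nonneg b i
  · by_cases h : vhat i ≤ b i
    · exact ordStat_le_pay (reserve := fun _ => vhat) hi h
    · have h1 := ordStat_le_of_mem_top hi (k := ℓ + 1) (by omega)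
      rw [keep, if_neg h] at h1
      rw [le_zero_iff.1 h1]
      exact auction_pay_nonneg b i

/-- If at most one bid deviates from the prediction, trusting it loses at most the highest value. -/
theorem le_revenue_trust {vhat b : Values n} {m : ℕ} (hm : 1 ≤ m) (h : deviations vhat b ≤ 1)
    (f : Values n → ℝ≥0) :
    ∑ k ∈ range ℓ, (ordStat b (k + 1) : ℝ) ≤
      ∑ i, (auction ℓ id (trustReserve vhat m f)).pay b i := by
  have h1 : ∑ k ∈ range (ℓ + 1), (ordStat b k : ℝ) ≤ ∑ i ∈ top (ℓ + 1) b, (b i : ℝ) :=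
    sum_range_ordStat_le_sum_top (fun _ => le_rfl) (fun _ _ => le_rfl) fun i hi => by
      exact_mod_cast ordStat_le_of_mem_top hi (by omega)
  rw [sum_range_succ'] at h1
  have h2 : ∑ i ∈ top (ℓ + 1) b, (b i : ℝ) ≤ ∑ i ∈ top (ℓ + 1) b,
      ((auction ℓ id (trustReserve vhat m f)).pay b i +
        if b i ≠ vhat i then (ordStat b 0 : ℝ) else 0) := by
    refine sum_le_sum fun i hi => ?_
    split_ifs with hb
    · have : (b i : ℝ) ≤ ordStat b 0 := by
        rw [← ordStat_descEquiv_symm b i]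
        exact_mod_cast ordStat_antitone b (Nat.zero_le _)
      have := auction_pay_nonneg (ℓ := ℓ) (score := id) (reserve := trustReserve vhat m f) b i
      linarith
    · rw [not_not] at hb
      have e := trustReserve_of_le (h.trans hm) f i
      have := reserve_le_pay (ℓ := ℓ) (score := id) (reserve := trustReserve vhat m f) (b := b)
        hi (by rw [e, hb])
      rw [e, ← hb] at this
      simpa using this
  have h3 : ∑ i ∈ top (ℓ + 1) b, (if b i ≠ vhat i then (ordStat b 0 : ℝ) else 0) ≤
      ordStat b 0 := by
    rw [← sum_filter, sum_const, nsmul_eq_mul]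
    refine mul_le_of_le_one_left (NNReal.coe_nonneg _) ?_
    have : #((top (ℓ + 1) b).filter fun i => b i ≠ vhat i) ≤ 1 :=
      (card_le_card (filter_subset_filter _ (subset_univ _))).trans h
    exact_mod_cast this
  rw [sum_add_distrib] at h2
  linarith [sum_le_sum_pay (ℓ := ℓ) (score := id) (reserve := trustReserve vhat m f) b
    (top (ℓ + 1) b)]

/-- The Vickrey auction. -/
theorem le_revenue_vickrey {vhat b : Values n} {m : ℕ} (h : m + 1 < deviations vhat b) :
    ((ℓ + 1 : ℕ) : ℝ) * ordStat b (ℓ + 1) ≤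
      ∑ i, (auction ℓ id (trustReserve vhat m fun _ => 0)).pay b i := by
  refine le_trans ?_ (sum_le_sum_pay b (top (ℓ + 1) b))
  refine le_trans ?_ (sum_le_sum fun i hi => ordStat_le_pay (score := id) hi
    (by rw [trustReserve_of_lt h]; exact zero_le))
  rw [sum_const, card_top, nsmul_eq_mul]
  rcases le_total (ℓ + 1) n with h | h
  · rw [min_eq_left h]; exact le_rfl
  · simp [ordStat_eq_zero b h]

/-- The Vickrey auction of a single item. -/
theorem le_revenue_second_price {vhat b : Values n} {m : ℕ} (h : m + 1 < deviations vhat b) :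
    (ordStat b 1 : ℝ) ≤
      ∑ i, (auction ℓ id (trustReserve vhat m fun y => ordStat y 0)).pay b i := by
  rcases n with _ | n
  · simp [ordStat_eq_zero]
  -- The highest bidder meets the highest bid of the others, and she alone already pays at least the
  -- second value.
  set i := descEquiv b 0
  have hi : ∀ k, i ∈ top (k + 1) b := fun k => mem_top.2 (by simp [i])
  have e := trustReserve_of_lt h (fun y => ordStat y 0) i
  have h1 := reserve_le_pay (ℓ := ℓ) (score := id)
    (reserve := trustReserve vhat m fun y => ordStat y 0) (hi ℓ)
    (by rw [e]; exact ordStat_update_le_of_mem_top (hi 0))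
  have h2 := sum_le_sum_pay (ℓ := ℓ) (score := id)
    (reserve := trustReserve vhat m fun y => ordStat y 0) b {i}
  rw [sum_singleton] at h2
  rw [e] at h1
  have h3 : (ordStat b 1 : ℝ) ≤ ordStat (Function.update b i 0) 0 := by
    exact_mod_cast ordStat_succ_le_update b i 0
  linarith

/-! ### Cost sharing -/

/-- The largest number of bidders, including the one who has been removed from `y`, that can share
the revenue `R` equally (and `1` if there is none). -/
noncomputable def sharers (L : ℕ) (R : ℝ≥0) (y : Values n) : ℝ≥0 :=
  max 1 ((Icc 2 L).sup fun k => if R ≤ k * ordStat y (k - 2) then (k : ℝ≥0) else 1)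

theorem exists_sharers_eq (L : ℕ) {R : ℝ≥0} (hR : 0 < R) {b : Values n}
    (h : R ≤ priceRevenue L b) :
    ∃ k : ℕ, 2 ≤ k ∧ k ≤ L ∧ R / k ≤ ordStat b (k - 1) ∧
      ∀ i, R / k ≤ b i → sharers L R (Function.update b i 0) = k := by
  classical
  let K := (Icc 2 L).filter fun k : ℕ => R / k ≤ ordStat b (k - 1)
  have hdiv : ∀ {k : ℕ}, 2 ≤ k → ∀ x : ℝ≥0, R / k ≤ x ↔ R ≤ k * x := fun hk x => by
    rw [div_le_iff₀ (by exact_mod_cast (by omega)), mul_comm]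
  have hKne : K.Nonempty := by
    have hl : 2 ≤ L := by
      by_contra hl
      have : priceRevenue L b = 0 := by simp [priceRevenue, Icc_eq_empty hl]
      exact absurd (hR.trans_le h) (by simp [this])
    obtain ⟨k, hk, hkl, e⟩ := exists_priceRevenue_eq hl b
    exact ⟨k, mem_filter.2 ⟨mem_Icc.2 ⟨hk, hkl⟩, (hdiv hk _).2 (e ▸ h)⟩⟩
  obtain ⟨hk1, hk2⟩ := mem_filter.1 (K.max'_mem hKne)
  set k := K.max' hKne with hkdef
  obtain ⟨hk, hkl⟩ := mem_Icc.1 hk1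
  refine ⟨k, hk, hkl, hk2, fun i hi => le_antisymm ?_ ?_⟩
  · refine max_le (by exact_mod_cast (by omega)) (Finset.sup_le fun j hj => ?_)
    obtain ⟨hj2, hjl⟩ := mem_Icc.1 hj
    split_ifs with hc
    · by_contra! hlt
      have hkj : k < j := by exact_mod_cast hlt
      have hpos : 0 < R / j := div_pos hR (by exact_mod_cast (by omega))
      have h1 : R / j ≤ b i := le_trans (by gcongr) hi
      have h2 := le_ordStat_succ_of_update hpos h1 ((hdiv hj2 _).2 hc)
      have h3 : j ∈ K := mem_filter.2 ⟨hj, by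
        rwa [show j - 2 + 1 = j - 1 by omega] at h2⟩
      exact absurd (K.le_max' j h3) (by omega)
    · exact_mod_cast (by omega)
  · refine le_trans ?_ (le_max_right _ _)
    refine le_trans ?_ (le_sup (f := fun k : ℕ =>
      if R ≤ k * ordStat (Function.update b i 0) (k - 2) then (k : ℝ≥0) else 1) hk1)
    have h1 := ordStat_succ_le_update b i (k - 2)
    rw [show k - 2 + 1 = k - 1 by omega] at h1
    rw [if_pos ((hdiv hk _).1 (hk2.trans h1))]

/-- If everybody is offered an equal share of the same attainable revenue `R`, then `R` is
collected. -/
theorem le_revenue_costSharing {R : ℝ≥0} (hR : 0 < R) {b : Values n}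
    (h : R ≤ priceRevenue (ℓ + 1) b)
    (hres : ∀ i, reserve b i = R / sharers (ℓ + 1) R (Function.update b i 0)) :
    (R : ℝ) ≤ ∑ i, (auction ℓ id reserve).pay b i := by
  obtain ⟨k, hk, hkl, hkR, hsh⟩ := exists_sharers_eq (ℓ + 1) hR h
  have hkpos : (0 : ℝ≥0) < k := by exact_mod_cast (by omega)
  have hkn : k ≤ n := by
    by_contra hlt
    rw [ordStat_eq_zero b (by omega)] at hkR
    exact absurd (div_pos hR hkpos) (not_lt.2 hkR)
  refine le_trans ?_ (sum_le_sum_pay b (top k b))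
  have key : ∀ i ∈ top k b, ((R / k : ℝ≥0) : ℝ) ≤ (auction ℓ id reserve).pay b i := by
    intro i hi
    have h1 : R / k ≤ b i := hkR.trans (ordStat_le_of_mem_top hi (by omega))
    have h2 : reserve b i = R / k := by rw [hres, hsh i h1]
    rw [← h2]
    exact reserve_le_pay (score := id) (mem_top.2 ((mem_top.1 hi).trans_le hkl)) (h2 ▸ h1)
  refine le_trans ?_ (sum_le_sum key)
  rw [sum_const, card_top, min_eq_left hkn, nsmul_eq_mul]
  have : (k : ℝ≥0) * (R / k) = R := mul_div_cancel₀ R hkpos.ne'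
  exact_mod_cast this.ge

end Auctions

/-! ### Randomized rounding to a geometric grid, making the revenue estimate agree for all bidders.
-/

section Consensus

/-- The revenue guaranteed by a consensus estimate on the grid `2 ^ (ℤ + u)`: the estimate of
`2 ^ Y`, provided that it is also the estimate of `2 ^ Z`. -/
noncomputable def consensus (Z Y u : ℝ) : ℝ :=
  if ⌊Z - u⌋ = ⌊Y - u⌋ then (2 : ℝ) ^ ((⌊Y - u⌋ : ℝ) + u) else 0

theorem consensus_periodic (Z Y : ℝ) : Function.Periodic (consensus Z Y) 1 := by
  intro u
  have h : ∀ W : ℝ, ⌊W - (u + 1)⌋ = ⌊W - u⌋ - 1 := fun W => by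
    rw [← Int.floor_sub_one]; congr 1; ring
  unfold consensus
  rw [h, h]
  simp only [sub_left_inj]
  congr 2
  push_cast
  ring

theorem integral_two_rpow (a b : ℝ) :
    ∫ x in a..b, (2 : ℝ) ^ x = ((2 : ℝ) ^ b - (2 : ℝ) ^ a) / Real.log 2 := by
  have hl : Real.log 2 ≠ 0 := (Real.log_pos one_lt_two).ne'
  rw [intervalIntegral.integral_eq_sub_of_hasDerivAt (f := fun x => (2 : ℝ) ^ x / Real.log 2)]
  · ring
  · intro x _
    have := ((Real.hasStrictDerivAt_const_rpow two_pos x).hasDerivAt).div_const (Real.log 2)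
    rwa [mul_div_assoc, div_self hl, mul_one] at this
  · exact (Real.continuous_const_rpow (by norm_num)).intervalIntegrable a b

/-- By periodicity the offset may range over `(Y - 1, Y]`. There `Y` rounds down to `u` itself, and
`Z` rounds to the same point exactly when `u ≤ Z`, leaving the integral of `2 ^ u` over `(Y - 1,
Z]`. -/
theorem integral_consensus {Z Y : ℝ} (h1 : Y - 1 ≤ Z) (h2 : Z ≤ Y) :
    ∫ u in Set.Ioc 0 1, consensus Z Y u = ((2 : ℝ) ^ Z - (2 : ℝ) ^ (Y - 1)) / Real.log 2 := by
  have e1 := (consensus_periodic Z Y).intervalIntegral_add_eq 0 (Y - 1)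
  rw [zero_add, sub_add_cancel, intervalIntegral.integral_of_le zero_le_one,
    intervalIntegral.integral_of_le (by linarith)] at e1
  rw [e1, ← integral_two_rpow, intervalIntegral.integral_of_le h1]
  have e2 : Set.Ioc (Y - 1) Z = Set.Ioc (Y - 1) Y ∩ Set.Iic Z := by
    ext x
    simp only [Set.mem_Ioc, Set.mem_inter_iff, Set.mem_Iic]
    exact ⟨fun h => ⟨⟨h.1, h.2.trans h2⟩, h.2⟩, fun h => ⟨h.1.1, h.2⟩⟩
  rw [e2, ← setIntegral_indicator measurableSet_Iic]
  refine setIntegral_congr_fun measurableSet_Ioc fun u hu => ?_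
  have hY : ⌊Y - u⌋ = 0 := Int.floor_eq_zero_iff.2 ⟨by linarith [hu.2], by linarith [hu.1]⟩
  unfold consensus
  rw [hY]
  by_cases hZ : u ≤ Z
  · have hZ' : ⌊Z - u⌋ = 0 :=
      Int.floor_eq_zero_iff.2 ⟨by linarith, by linarith [hu.1]⟩
    rw [if_pos hZ', Set.indicator_of_mem (by exact hZ)]
    simp
  · have hZ' : ⌊Z - u⌋ ≠ 0 := fun h0 => by
      have := (Int.floor_eq_zero_iff.1 h0).1
      linarith
    rw [if_neg hZ', Set.indicator_of_notMem (by exact hZ)]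

theorem consensus_nonneg (Z Y u : ℝ) : 0 ≤ consensus Z Y u := by
  unfold consensus; split_ifs <;> positivity

theorem measurable_consensus (Z Y : ℝ) : Measurable (consensus Z Y) := by
  have h : ∀ W : ℝ, Measurable fun u : ℝ => ⌊W - u⌋ := fun W =>
    (measurable_const.sub measurable_id).floor
  have h' : Measurable fun u : ℝ => ((⌊Y - u⌋ : ℝ) + u) :=
    (measurable_from_top.comp (h Y)).add measurable_id
  exact Measurable.ite (measurableSet_eq_fun (h Z) (h Y)) (measurable_const.pow h') measurable_const

theorem integrable_consensus (Z Y : ℝ) :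
    Integrable (consensus Z Y) (volume.restrict (Set.Ioc 0 1)) := by
  refine Integrable.of_bound (measurable_consensus Z Y).aestronglyMeasurable ((2 : ℝ) ^ Y)
    (Filter.Eventually.of_forall fun u => ?_)
  rw [Real.norm_of_nonneg (consensus_nonneg Z Y u)]
  unfold consensus
  split_ifs
  · exact Real.rpow_le_rpow_of_exponent_le one_le_two (by linarith [Int.floor_le (Y - u)])
  · positivity

/-- The largest point of the grid `2 ^ (ℤ + u)` that is at most `x`. -/
noncomputable def gridFloor (u : ℝ) (x : ℝ≥0) : ℝ≥0 :=
  (2 : ℝ≥0) ^ ((⌊Real.logb 2 x - u⌋ : ℝ) + u)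

theorem gridFloor_pos (u : ℝ) (x : ℝ≥0) : 0 < gridFloor u x := NNReal.rpow_pos two_pos

theorem gridFloor_le (u : ℝ) {x : ℝ≥0} (hx : 0 < x) : gridFloor u x ≤ x := by
  have h : ((gridFloor u x : ℝ≥0) : ℝ) ≤ x := by
    rw [gridFloor, NNReal.coe_rpow]
    calc (2 : ℝ) ^ ((⌊Real.logb 2 x - u⌋ : ℝ) + u) ≤ (2 : ℝ) ^ Real.logb 2 x :=
          Real.rpow_le_rpow_of_exponent_le one_le_two
            (by linarith [Int.floor_le (Real.logb 2 x - u)])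
      _ = x := Real.rpow_logb two_pos (by norm_num) (by exact_mod_cast hx)
  exact_mod_cast h

theorem measurable_gridFloor (x : ℝ≥0) : Measurable fun u => gridFloor u x := by
  have h : Measurable fun u : ℝ => ((⌊Real.logb 2 x - u⌋ : ℝ) + u) :=
    (measurable_from_top.comp (measurable_const.sub measurable_id).floor).add measurable_id
  exact measurable_const.pow h

variable {n : ℕ}

theorem measurable_sharers (L : ℕ) (y : Values n) : Measurable fun R => sharers L R y := by
  refine measurable_const.max ?_
  induction Icc 2 L using Finset.induction_on with
  | empty => simp
  | insert k s hk ih =>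
    simp only [sup_insert]
    exact (Measurable.ite (measurableSet_le measurable_id measurable_const) measurable_const
      measurable_const).sup ih

/-- The equal share of the estimated single-price revenue. -/
noncomputable def consensusPrice (L : ℕ) (u : ℝ) (y : Values n) : ℝ≥0 :=
  gridFloor u (priceRevenue L y) / sharers L (gridFloor u (priceRevenue L y)) y

theorem measurable_consensusPrice (L : ℕ) (y : Values n) :
    Measurable fun u => consensusPrice L u y :=
  (measurable_gridFloor _).div ((measurable_sharers L y).comp (measurable_gridFloor _))

/-- The consensus auction collects the consensus estimate. -/
theorem consensus_le_revenue {ℓ m : ℕ} {vhat b : Values n} (h : m + 1 < deviations vhat b) {k : ℕ}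
    (hk : 3 ≤ k) (hkl : k ≤ ℓ + 1) (hG : priceRevenue (ℓ + 1) b = k * ordStat b (k - 1))
    (hpos : 0 < ordStat b (k - 1)) (u : ℝ) :
    consensus (Real.logb 2 ((k - 1) * ordStat b (k - 1))) (Real.logb 2 (k * ordStat b (k - 1))) u ≤
      ∑ i, (auction ℓ id (trustReserve vhat m (consensusPrice (ℓ + 1) u))).pay b i := by
  set w := ordStat b (k - 1)
  have hw : (0 : ℝ) < w := by exact_mod_cast hpos
  have hk' : (3 : ℝ) ≤ k := by exact_mod_cast hk
  unfold consensus
  split_ifs with hc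
  swap
  · exact sum_nonneg fun i _ => auction_pay_nonneg b i
  have hGpos : 0 < priceRevenue (ℓ + 1) b := by
    rw [hG]; exact mul_pos (by exact_mod_cast (by omega)) hpos
  have hGr : ((priceRevenue (ℓ + 1) b : ℝ≥0) : ℝ) = k * w := by rw [hG]; push_cast; rfl
  -- Removing one bid leaves `k - 1` bidders at `w`, so the estimated quantity stays between `(k -
  -- 1) w` and `k w`; if both ends round to the same grid point, so does everything between. Here `k
  -- ≥ 3` keeps `k - 1` an admissible number of sales.
  have hsame : ∀ i, gridFloor u (priceRevenue (ℓ + 1) (Function.update b i 0)) =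
      gridFloor u (priceRevenue (ℓ + 1) b) := by
    intro i
    have h1 : priceRevenue (ℓ + 1) (Function.update b i 0) ≤ priceRevenue (ℓ + 1) b :=
      priceRevenue_mono _ (update_zero_le b i)
    have h2 : ((k - 1 : ℕ) : ℝ≥0) * w ≤ priceRevenue (ℓ + 1) (Function.update b i 0) := by
      refine le_trans (mul_le_mul_right ?_ _) (le_priceRevenue (k := k - 1) (by omega) (by omega) _)
      have := ordStat_succ_le_update b i (k - 1 - 1)
      rwa [show k - 1 - 1 + 1 = k - 1 by omega] at this
    have h2' : ((k : ℝ) - 1) * w ≤ priceRevenue (ℓ + 1) (Function.update b i 0) := by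
      have : (((k - 1 : ℕ) : ℝ≥0) : ℝ) = (k : ℝ) - 1 := by
        rw [NNReal.coe_natCast, Nat.cast_sub (by omega), Nat.cast_one]
      rw [← this]; exact_mod_cast h2
    have h1' : ((priceRevenue (ℓ + 1) (Function.update b i 0) : ℝ≥0) : ℝ) ≤ k * w := by
      rw [← hGr]; exact_mod_cast h1
    have hp : 0 < ((k : ℝ) - 1) * w := mul_pos (by linarith) hw
    have f1 := Int.floor_le_floor (sub_le_sub_right
      (Real.logb_le_logb_of_le one_lt_two hp h2') u)
    have f2 := Int.floor_le_floor (sub_le_sub_right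
      (Real.logb_le_logb_of_le one_lt_two (hp.trans_le h2') h1') u)
    rw [gridFloor, gridFloor, hGr, le_antisymm f2 (hc ▸ f1)]
  have := le_revenue_costSharing (ℓ := ℓ)
    (reserve := trustReserve vhat m (consensusPrice (ℓ + 1) u))
    (gridFloor_pos u _) (gridFloor_le u hGpos) fun i => by
      rw [trustReserve_of_lt h, consensusPrice, hsame]
  refine le_trans (le_of_eq ?_) this
  rw [gridFloor, NNReal.coe_rpow, hGr]
  rfl

end Consensus

/-! ### Mixtures of finitely many families of mechanisms sharing a uniform seed. -/

section Mixtures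

variable {n : ℕ} {ι : Type} [Fintype ι] [MeasurableSpace ι] [MeasurableSingletonClass ι]

/-- The mechanism `D a u` is run with probability `p a`, for a uniform `u ∈ (0, 1]`. -/
noncomputable def mixture (p : ι → ℝ) (hp : ∀ a, 0 ≤ p a) (hsum : ∑ a, p a = 1)
    (D : ι → ℝ → DetMechanism n)
    (hwin : ∀ a b i, MeasurableSet {u | i ∈ (D a u).winners b})
    (hpay : ∀ a b i, Measurable fun u => (D a u).pay b i) : RandMechanism n where
  Ω := ι × ℝ
  μ := ∑ a, ENNReal.ofReal (p a) • (volume.restrict (Set.Ioc (0 : ℝ) 1)).map (Prod.mk a)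
  isProb := ⟨by
    have : ∀ a : ι, ((volume.restrict (Set.Ioc (0 : ℝ) 1)).map (Prod.mk a)) Set.univ = 1 :=
      fun a => by rw [Measure.map_apply measurable_prodMk_left MeasurableSet.univ]; simp
    simp only [Measure.finsetSum_apply, Measure.smul_apply, this, smul_eq_mul, mul_one]
    rw [← ENNReal.ofReal_sum_of_nonneg fun a _ => hp a, hsum, ENNReal.ofReal_one]⟩
  det ω := D ω.1 ω.2
  measurableSet_win b i := measurableSet_setOfPred.2
    (measurable_from_prod_countable_right fun a => measurableSet_setOfPred.1 (hwin a b i))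
  measurable_pay b i := measurable_from_prod_countable_right fun a => hpay a b i

/-- Individual rationality bounds each payment by the bid, which gives integrability; that part is
kept in the conclusion for later monotonicity of integrals. -/
theorem mixture_revenue {p : ι → ℝ} {hp : ∀ a, 0 ≤ p a} {hsum : ∑ a, p a = 1}
    {D : ι → ℝ → DetMechanism n}
    {hwin : ∀ a b i, MeasurableSet {u | i ∈ (D a u).winners b}}
    {hpay : ∀ a b i, Measurable fun u => (D a u).pay b i}
    (hD : ∀ a u, (D a u).IndividuallyRational) (b : Values n) :
    (∀ a, Integrable (fun u => ∑ i, (D a u).pay b i) (volume.restrict (Set.Ioc 0 1))) ∧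
    (mixture p hp hsum D hwin hpay).revenue b =
      ∑ a, p a * ∫ u in Set.Ioc 0 1, ∑ i, (D a u).pay b i := by
  have hm : Measurable fun ω : ι × ℝ => ∑ i, (D ω.1 ω.2).pay b i :=
    Finset.measurable_fun_sum _ fun i _ => measurable_from_prod_countable_right fun a => hpay a b i
  have hint : ∀ a, Integrable (fun u => ∑ i, (D a u).pay b i)
      (volume.restrict (Set.Ioc 0 1)) := by
    intro a
    refine integrable_finsetSum _ fun i _ => ?_
    refine Integrable.of_bound (hpay a b i).aestronglyMeasurable (b i : ℝ)
      (Filter.Eventually.of_forall fun u => ?_)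
    by_cases hi : i ∈ (D a u).winners b
    · obtain ⟨h0, h1⟩ := (hD a u b i).1 hi
      rwa [Real.norm_of_nonneg h0]
    · rw [(hD a u b i).2 hi]
      simp
  refine ⟨hint, ?_⟩
  change ∫ ω, ∑ i, (D ω.1 ω.2).pay b i ∂(∑ a, ENNReal.ofReal (p a) •
    (volume.restrict (Set.Ioc (0 : ℝ) 1)).map (Prod.mk a)) = _
  rw [integral_finsetSum_measure]
  · refine sum_congr rfl fun a _ => ?_
    rw [integral_smul_measure, ENNReal.toReal_ofReal (hp a), smul_eq_mul,
      integral_map measurable_prodMk_left.aemeasurable hm.aestronglyMeasurable]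
  · intro a _
    refine Integrable.smul_measure ?_ ENNReal.ofReal_ne_top
    rw [integrable_map_measure hm.aestronglyMeasurable measurable_prodMk_left.aemeasurable]
    exact hint a

end Mixtures

/-! ### The four-auction mixture and its guarantees. -/

section Main

variable {n : ℕ}

/-- The scores of the four auctions that are mixed. -/
noncomputable def mixedScore (vhat : Values n) : Fin 4 → Values n → Values n
  | 0 => keep vhat
  | _ => id

/-- The reserves of the four auctions that are mixed: the predicted values, and the Vickrey auction,
the Vickrey auction of one item and the consensus auction, each replaced by the predicted values
next to the prediction. -/
noncomputable def mixedReserve (ℓ : ℕ) (vhat : Values n) (u : ℝ) : Fin 4 → Values n → Values n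
  | 0 => fun _ => vhat
  | 1 => trustReserve vhat 1 fun _ => 0
  | 2 => trustReserve vhat 0 fun y => ordStat y 0
  | 3 => trustReserve vhat 0 (consensusPrice (ℓ + 1) u)

/-- The four auctions that are mixed. -/
noncomputable def mixedAuction (ℓ : ℕ) (vhat : Values n) (a : Fin 4) (u : ℝ) : DetMechanism n :=
  auction ℓ (mixedScore vhat a) (mixedReserve ℓ vhat u a)

/-- The probabilities of the four auctions. -/
noncomputable def mixedWeight : Fin 4 → ℝ
  | 0 => 1 - (3 + 2 * Real.log 2) / 5.42
  | 1 => 1 / 5.42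
  | 2 => 2 / 5.42
  | 3 => 2 * Real.log 2 / 5.42

/-- This is `4 + 2 log 2 ≤ 5.42`, the only numerical estimate behind the robustness constant. -/
theorem mixedWeight_zero : 1 / 5.42 ≤ mixedWeight 0 := by
  have := Real.log_two_lt_d9
  simp only [mixedWeight]
  rw [le_sub_iff_add_le, ← add_div, div_le_one (by norm_num)]
  linarith

theorem mixedWeight_nonneg (a : Fin 4) : 0 ≤ mixedWeight a := by
  have h0 := mixedWeight_zero
  have hl := Real.log_pos one_lt_two
  match a with
  | 0 => exact le_trans (by norm_num) h0
  | 1 => simp only [mixedWeight]; norm_num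
  | 2 => simp only [mixedWeight]; norm_num
  | 3 => simp only [mixedWeight]; positivity

theorem sum_mixedWeight : ∑ a, mixedWeight a = 1 := by
  simp only [Fin.sum_univ_four, mixedWeight]
  ring

theorem mixedReserve_bidIndependent (ℓ : ℕ) (vhat : Values n) (u : ℝ) (a : Fin 4) :
    BidIndependent (mixedReserve ℓ vhat u a) :=
  match a with
  | 0 => fun _ _ _ => rfl
  | 1 => trustReserve_bidIndependent vhat 1 fun _ => 0
  | 2 => trustReserve_bidIndependent vhat 0 fun y => ordStat y 0
  | 3 => trustReserve_bidIndependent vhat 0 (consensusPrice (ℓ + 1) u)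

theorem mixedScore_proper (ℓ : ℕ) (vhat : Values n) (u : ℝ) (a : Fin 4) :
    ProperScore (mixedScore vhat a) (mixedReserve ℓ vhat u a) :=
  match a with
  | 0 => properScore_keep vhat
  | 1 | 2 | 3 => properScore_id _

theorem mixedReserve_self (ℓ : ℕ) (vhat : Values n) (u : ℝ) (a : Fin 4) :
    mixedReserve ℓ vhat u a vhat = vhat :=
  match a with
  | 0 => rfl
  | 1 => trustReserve_self vhat 1 fun _ => 0
  | 2 => trustReserve_self vhat 0 fun y => ordStat y 0
  | 3 => trustReserve_self vhat 0 (consensusPrice (ℓ + 1) u)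

theorem mixedScore_self (vhat : Values n) (a : Fin 4) : mixedScore vhat a vhat = vhat :=
  match a with
  | 0 => funext fun _ => if_pos le_rfl
  | 1 | 2 | 3 => rfl

theorem measurable_mixedReserve (ℓ : ℕ) (vhat b : Values n) (a : Fin 4) (i : Fin n) :
    Measurable fun u => mixedReserve ℓ vhat u a b i :=
  match a with
  | 0 | 1 | 2 => measurable_const
  | 3 => by
    simp only [mixedReserve, trustReserve]
    split_ifs
    · exact measurable_const
    · exact measurable_consensusPrice _ _

theorem measurableSet_mixedAuction_winners (ℓ : ℕ) (vhat : Values n) (a : Fin 4) (b : Values n)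
    (i : Fin n) : MeasurableSet {u | i ∈ (mixedAuction ℓ vhat a u).winners b} := by
  have h : MeasurableSet {u | mixedReserve ℓ vhat u a b i ≤ b i} :=
    measurableSet_le (measurable_mixedReserve ℓ vhat b a i) measurable_const
  simp only [mixedAuction, mem_winners_auction]
  exact (MeasurableSet.const _).inter h

theorem measurable_mixedAuction_pay (ℓ : ℕ) (vhat : Values n) (a : Fin 4) (b : Values n)
    (i : Fin n) : Measurable fun u => (mixedAuction ℓ vhat a u).pay b i := by
  have h : Measurable fun u => ((max (mixedReserve ℓ vhat u a b i)
      (ordStat (Function.update (mixedScore vhat a b) i 0) ℓ) : ℝ≥0) : ℝ) :=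
    ((measurable_mixedReserve ℓ vhat b a i).max measurable_const).coe_nnreal_real
  exact Measurable.ite (measurableSet_mixedAuction_winners ℓ vhat a b i) h measurable_const

theorem mixedAuction_individuallyRational (ℓ : ℕ) (vhat : Values n) (a : Fin 4) (u : ℝ) :
    (mixedAuction ℓ vhat a u).IndividuallyRational :=
  auction_individuallyRational (mixedScore_proper ℓ vhat u a)

/-- The mixture of the four auctions. -/
noncomputable def mixedMechanism (ℓ : ℕ) (vhat : Values n) : RandMechanism n :=
  mixture mixedWeight mixedWeight_nonneg sum_mixedWeight (mixedAuction ℓ vhat)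
    (measurableSet_mixedAuction_winners ℓ vhat) (measurable_mixedAuction_pay ℓ vhat)

/-- Expected revenue of the four auctions. -/
noncomputable def mixedRevenue (ℓ : ℕ) (vhat b : Values n) (a : Fin 4) : ℝ :=
  ∫ u in Set.Ioc 0 1, ∑ i, (mixedAuction ℓ vhat a u).pay b i

theorem mixedMechanism_revenue (ℓ : ℕ) (vhat b : Values n) :
    (mixedMechanism ℓ vhat).revenue b = ∑ a, mixedWeight a * mixedRevenue ℓ vhat b a :=
  (mixture_revenue (mixedAuction_individuallyRational ℓ vhat) b).2

theorem integral_le_mixedRevenue {ℓ : ℕ} {vhat b : Values n} {a : Fin 4} {f : ℝ → ℝ}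
    (hf : Integrable f (volume.restrict (Set.Ioc 0 1)))
    (h : ∀ u, f u ≤ ∑ i, (mixedAuction ℓ vhat a u).pay b i) :
    ∫ u in Set.Ioc 0 1, f u ≤ mixedRevenue ℓ vhat b a :=
  integral_mono hf ((mixture_revenue (hp := mixedWeight_nonneg) (hsum := sum_mixedWeight)
    (hwin := measurableSet_mixedAuction_winners ℓ vhat)
    (hpay := measurable_mixedAuction_pay ℓ vhat)
    (mixedAuction_individuallyRational ℓ vhat) b).1 a) h

theorem le_mixedRevenue {ℓ : ℕ} {vhat b : Values n} {a : Fin 4} {c : ℝ}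
    (h : ∀ u, c ≤ ∑ i, (mixedAuction ℓ vhat a u).pay b i) : c ≤ mixedRevenue ℓ vhat b a := by
  have := integral_le_mixedRevenue (integrable_const c) h
  simpa using this

theorem mixedRevenue_nonneg (ℓ : ℕ) (vhat b : Values n) (a : Fin 4) :
    0 ≤ mixedRevenue ℓ vhat b a :=
  le_mixedRevenue fun _ => sum_nonneg fun i _ => auction_pay_nonneg b i

theorem OPT_le_mixedMechanism_revenue (ℓ : ℕ) (vhat : Values n) :
    OPT (limitedSupply n (ℓ + 1)) vhat ≤ (mixedMechanism ℓ vhat).revenue vhat := by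
  rw [mixedMechanism_revenue, ← one_mul (OPT _ _), ← sum_mixedWeight, sum_mul]
  exact sum_le_sum fun a _ => mul_le_mul_of_nonneg_left
    (le_mixedRevenue fun u => OPT_le_sum_pay (mixedScore_self vhat a)
      (mixedReserve_self ℓ vhat u a)) (mixedWeight_nonneg a)

theorem le_mixedRevenue_consensus {ℓ : ℕ} {vhat b : Values n} (h : 1 < deviations vhat b) {k : ℕ}
    (hk : 3 ≤ k) (hkl : k ≤ ℓ + 1) (hG : priceRevenue (ℓ + 1) b = k * ordStat b (k - 1)) :
    (k - 2) * (ordStat b (k - 1) : ℝ) ≤ 2 * Real.log 2 * mixedRevenue ℓ vhat b 3 := by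
  have hl := Real.log_pos one_lt_two
  rcases eq_or_lt_of_le (zero_le : 0 ≤ ordStat b (k - 1)) with h0 | hpos
  · rw [← h0]
    have := mixedRevenue_nonneg ℓ vhat b 3
    simpa using by positivity
  have hk' : (3 : ℝ) ≤ k := by exact_mod_cast hk
  have hw : (0 : ℝ) < ordStat b (k - 1) := by exact_mod_cast hpos
  have h1 := integral_le_mixedRevenue (integrable_consensus _ _)
    (fun u => consensus_le_revenue (m := 0) h hk hkl hG hpos u)
    (a := 3)
  have hlo : 0 < ((k : ℝ) - 1) * ordStat b (k - 1) := mul_pos (by linarith) hw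
  have hhi : 0 < (k : ℝ) * ordStat b (k - 1) := by positivity
  have e : Real.logb 2 ((k : ℝ) * ordStat b (k - 1)) - 1 =
      Real.logb 2 ((k : ℝ) * ordStat b (k - 1) / 2) := by
    rw [Real.logb_div hhi.ne' two_ne_zero, Real.logb_self_eq_one one_lt_two]
  -- With `w = ordStat b (k - 1)` the integral is `((k - 1) w - k w / 2) / log 2 = (k - 2) w / (2
  -- log 2)`, which explains the weight `2 log 2`.
  rw [integral_consensus, e, Real.rpow_logb two_pos (by norm_num) hlo,
    Real.rpow_logb two_pos (by norm_num) (by positivity), div_le_iff₀ hl] at h1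
  · linarith
  · rw [e]
    exact Real.logb_le_logb_of_le one_lt_two (by positivity) (by nlinarith)
  · exact Real.logb_le_logb_of_le one_lt_two hlo (by nlinarith)

/-- The case split is on the number of deviations: at most one uses auctions 0 and 1, exactly two
uses 0 and 2, and at least three uses 1, 2 and 3 (only auction 2 when a single unit is for sale). -/
theorem EFO2_le_mixedRevenue (ℓ : ℕ) (vhat b : Values n) :
    EFO2 (limitedSupply n (ℓ + 1)) b ≤ mixedRevenue ℓ vhat b 0 + mixedRevenue ℓ vhat b 1 +
      2 * mixedRevenue ℓ vhat b 2 + 2 * Real.log 2 * mixedRevenue ℓ vhat b 3 := by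
  have hn := mixedRevenue_nonneg ℓ vhat b
  have hn0 := hn 0
  have hn1 := hn 1
  have hn2 := hn 2
  have hn3 : 0 ≤ 2 * Real.log 2 * mixedRevenue ℓ vhat b 3 :=
    mul_nonneg (by have := Real.log_pos one_lt_two; linarith) (hn 3)
  have hE := EFO2_le_sum (ℓ + 1) b
  rw [sum_range_succ'] at hE
  have hmax : ∀ k, max 1 (k + 1) = k + 1 := fun k => by omega
  simp only [hmax, max_eq_left (Nat.zero_le 1)] at hE
  have hT : ∑ k ∈ range (ℓ + 1), (ordStat b (k + deviations vhat b) : ℝ) ≤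
      mixedRevenue ℓ vhat b 0 := le_mixedRevenue fun u => le_revenue_predicted vhat b
  rcases Nat.lt_or_ge 1 (deviations vhat b) with hd | hd
  swap
  · have h1 : ∑ k ∈ range ℓ, (ordStat b (k + 1) : ℝ) ≤ mixedRevenue ℓ vhat b 1 :=
      le_mixedRevenue fun u => le_revenue_trust le_rfl hd _
    have h2 : ∑ k ∈ range (ℓ + 1), (ordStat b (k + 1) : ℝ) ≤
        ∑ k ∈ range (ℓ + 1), (ordStat b (k + deviations vhat b) : ℝ) :=
      sum_le_sum fun k _ => by exact_mod_cast ordStat_antitone b (by omega)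
    have h3 : (ordStat b 1 : ℝ) ≤ ∑ k ∈ range (ℓ + 1), (ordStat b (k + 1) : ℝ) :=
      single_le_sum (f := fun k => (ordStat b (k + 1) : ℝ)) (fun k _ => NNReal.coe_nonneg _)
        (mem_range.2 (Nat.succ_pos ℓ))
    linarith
  have h2 : (ordStat b 1 : ℝ) ≤ mixedRevenue ℓ vhat b 2 :=
    le_mixedRevenue fun u => le_revenue_second_price hd
  rcases Nat.lt_or_ge 2 (deviations vhat b) with hd2 | hd2
  swap
  · have hd' : deviations vhat b = 2 := by omega
    rw [hd', sum_range_succ] at hT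
    have h3 := sum_range_succ (fun k => (ordStat b (k + 1) : ℝ)) ℓ
    rw [sum_range_succ'] at h3
    have h4 : (0 : ℝ) ≤ ordStat b (ℓ + 1) := NNReal.coe_nonneg _
    have h5 : (0 : ℝ) ≤ ordStat b (ℓ + 2) := NNReal.coe_nonneg _
    simp only [zero_add, add_assoc, one_add_one_eq_two] at h3
    linarith
  rcases Nat.eq_zero_or_pos ℓ with rfl | hl
  · simp only [range_zero, sum_empty, zero_add] at hE
    linarith
  have hE' := EFO2_le_add (by omega : 2 ≤ ℓ + 1) b
  have hV : ((ℓ + 1 : ℕ) : ℝ) * ordStat b (ℓ + 1) ≤ mixedRevenue ℓ vhat b 1 :=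
    le_mixedRevenue fun u => le_revenue_vickrey hd2
  obtain ⟨k, hk, hkl, hG⟩ := exists_priceRevenue_eq (by omega : 2 ≤ ℓ + 1) b
  have hG' : (priceRevenue (ℓ + 1) b : ℝ) = k * (ordStat b (k - 1) : ℝ) := by
    rw [hG]; push_cast; rfl
  have hle : (ordStat b (k - 1) : ℝ) ≤ ordStat b 1 := by
    exact_mod_cast ordStat_antitone b (by omega)
  -- For `k = 2` the price revenue is twice the second value, paid for by auction 2. For `k ≥ 3`,
  -- auction 2 covers two of the `k` units and consensus the remaining `k - 2`.
  rcases hk.eq_or_lt with rfl | hk3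
  · push_cast at hG'
    linarith
  · have hC := le_mixedRevenue_consensus hd hk3 hkl hG
    linarith

theorem EFO2_le_mixedMechanism_revenue (ℓ : ℕ) (vhat b : Values n) :
    EFO2 (limitedSupply n (ℓ + 1)) b / 5.42 ≤ (mixedMechanism ℓ vhat).revenue b := by
  rw [mixedMechanism_revenue, Fin.sum_univ_four]
  have h0 := mul_le_mul_of_nonneg_right mixedWeight_zero (mixedRevenue_nonneg ℓ vhat b 0)
  have hE := div_le_div_of_nonneg_right (EFO2_le_mixedRevenue ℓ vhat b)
    (by norm_num : (0 : ℝ) ≤ 5.42)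
  refine hE.trans (le_trans (le_of_eq ?_)
    (add_le_add_left (add_le_add_left (add_le_add_left h0 _) _) _))
  simp only [mixedWeight]
  ring

/-- The mechanism that serves nobody. -/
noncomputable def nullMechanism (n : ℕ) : RandMechanism n where
  Ω := Unit
  μ := Measure.dirac ()
  det _ := ⟨fun _ => ∅, fun _ _ => 0⟩
  measurableSet_win _ _ := by simp
  measurable_pay _ _ := measurable_const

theorem nullMechanism_revenue (b : Values n) : (nullMechanism n).revenue b = 0 := by
  simp only [RandMechanism.revenue, nullMechanism, sum_const_zero]
  exact integral_zero _ _

end Main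

theorem mainTheorem6 (n ℓ : ℕ) :
    ∃ M : Values n → RandMechanism n,
      (∀ vhat : Values n, (M vhat).Truthful ∧ (M vhat).Feasible ℓ ∧
        (M vhat).IndividuallyRational) ∧
      Consistent M 1 (OPT (limitedSupply n ℓ)) ∧
      Robust M 5.42 (EFO2 (limitedSupply n ℓ)) := by
  rcases ℓ with _ | ℓ
  · refine ⟨fun _ => nullMechanism n, fun _ => ⟨fun _ v i z => ?_, fun _ b => ?_, fun _ b i => ?_⟩,
      fun vhat => ?_, fun _ v => ?_⟩
    · simp [nullMechanism, DetMechanism.utility]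
    · simp [nullMechanism]
    · simp [nullMechanism]
    · rw [nullMechanism_revenue, div_one]
      exact (OPT_le 0 vhat).trans_eq (by simp [top])
    · rw [nullMechanism_revenue]
      exact div_nonpos_of_nonpos_of_nonneg ((EFO2_le_sum 0 v).trans_eq (by simp)) (by norm_num)
  · refine ⟨mixedMechanism ℓ, fun vhat => ⟨fun ω => ?_, fun ω => auction_feasible, fun ω => ?_⟩,
      fun vhat => ?_, EFO2_le_mixedMechanism_revenue ℓ⟩
    · exact auction_truthful (mixedReserve_bidIndependent ℓ vhat ω.2 ω.1)
        (mixedScore_proper ℓ vhat ω.2 ω.1)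
    · exact mixedAuction_individuallyRational ℓ vhat ω.1 ω.2
    · rw [div_one]
      exact OPT_le_mixedMechanism_revenue ℓ vhat
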